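/- For a finite simple graph $G$ let $\alpha(G)$ denote its independence number, and let $\alpha_m(G)$ denote the minimum of $\alpha(H)$ over all subgraphs $H$ of $G$ on exactly $m$ vertices (so $\alpha_m(G)\ge r$ means that every set of $m$ vertices of $G$ contains an independent set of size $r$). Let $m$ and $r\ge 2$ be integers, let $k=\lceil m/(r-1)\rceil$, and suppose that $k\ge 3$ and $m\le (k-\frac12)(r-1)$. Then there is a constant $c=c(m,r)>0$ such that for every $n$, every $n$-vertex graph $G$ with $\alpha_m(G)\ge r$ satisfies $$\alpha(G)\ \ge\ c\, n^{\frac{1}{k-3/2}}.$$ -/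

import Mathlib

/-- The `m`-local independence number `α_m(G)`: the minimum independence number among the
subgraphs of `G` on `m` vertices. Deleting edges cannot decrease the independence number, so it is
enough to take the minimum over the induced subgraphs. The value is `⊤` if `G` has fewer than `m`
vertices. -/
noncomputable def SimpleGraph.localIndepNum {V : Type*} (G : SimpleGraph V) (m : ℕ) : ℕ∞ :=
  ⨅ S : {S : Finset V // S.card = m}, ((G.induce (S.1 : Set V)).indepNum : ℕ∞)

/-!
Write `k = n + 2` and let `s` be an integer slightly larger than the square root of `α(G)`, so that
`G` has no independent set of size `s ^ 2`. The heart of the matter is `exists_locally_dense`: if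
`G` has more than `C * s ^ (2 * n + 1)` vertices, it contains a *locally dense* set, one of
`2 * n + 3 = 2 * k - 1` vertices without an independent triple. Since `2 * m ≤ (2 * k - 1) * (r - 1)`,
about `(r - 1) / 2` disjoint locally dense sets, together with a `(k - 1)`-clique if `r - 1` is odd,
cover `m` vertices and contain no independent set of size `r` (`exists_card_eq_indep_le`). So `G`
has at most `C * s ^ (2 * k - 3)` vertices, and `s ^ 2` is of the order of `α(G)`.

A `k`-clique together with a disjoint `(k - 1)`-clique is locally dense, so one may assume that `G`
has no `k`-clique. Say that an `n`-clique *links* `v` and `a` if it is joined completely to both. Two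
disjoint links, from `v` to `a` and from `v` to `b`, give a locally dense set as soon as `a` and `b`
are adjacent (`exists_card_indep_le_two_of_links`). Now look at a five-cycle `v x w w' x'` joined
completely to an `(n - 1)`-clique `Q`. The links `Q ∪ {x}` and `Q ∪ {x'}` lead from `v` to the
adjacent vertices `w` and `w'`, but they overlap in `Q`. Given many such configurations at the same
`v` with disjoint sets `Q ∪ {x, x'}`, however, the vertices `w` are distinct and form an independent
set. Hence fewer than `s ^ 2` of them are disjoint, and every vertex `v` has a set `Z v` of at most
`(n + 1) * s ^ 2` neighbours that meets every such configuration at `v`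
(`exists_small_transversal`).

It remains to find a configuration at some `v` that avoids `Z v`. In a triangle-free set of more
than `6 * s ^ 3` vertices the neighbourhoods cannot all expand badly, which yields a five-cycle, even
when each vertex `v` of the set has up to `s` forbidden neighbours there (`exists_fiveCycle`). To get
into this situation, note that adjacent vertices have few common neighbours, as `G` has no
`k`-clique; so on average a neighbourhood contains so few pairs `(v, z)` with `z ∈ Z v` that, after
deleting some vertices, every vertex is in at most `s` of them (`exists_nbhd_few_arcs`). Within such
a neighbourhood the clique `Q` is completed greedily (`exists_clique_large_common_nbhd`), until the
common neighbourhood is triangle-free and still has more than `6 * s ^ 3` vertices.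
-/

/-! ### Independent sets, degrees and cliques -/

namespace SimpleGraph

variable {V : Type*} [DecidableEq V] (G : SimpleGraph V) [DecidableRel G.Adj]

/-- A maximum independent subset of `M` dominates `M`, so one of its vertices has many neighbours
in `M`. -/
lemma exists_card_le_mul_degree {t : ℕ}
    (hα : ∀ I : Finset V, G.IsIndepSet (I : Set V) → I.card < t) {M : Finset V}
    (hM : M.Nonempty) :
    ∃ x ∈ M, M.card ≤ t * ((M.filter (G.Adj x)).card + 1) := by
  classical
  obtain ⟨I, hI, hmax⟩ := Finset.exists_max_image
    (M.powerset.filter fun I : Finset V => G.IsIndepSet (I : Set V)) Finset.card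
    ⟨∅, by simp [IsIndepSet]⟩
  simp only [Finset.mem_filter, Finset.mem_powerset] at hI hmax
  obtain ⟨x, hx, hxmax⟩ := Finset.exists_max_image M (fun x => (M.filter (G.Adj x)).card) hM
  refine ⟨x, hx, ?_⟩
  have hcov : M ⊆ I.biUnion fun u => insert u (M.filter (G.Adj u)) := by
    intro y hy
    simp only [Finset.mem_biUnion, Finset.mem_insert, Finset.mem_filter]
    by_contra! hcon
    have hyI : y ∉ I := fun h => (hcon y h).1 rfl
    have hind : G.IsIndepSet (↑(insert y I) : Set V) := by
      rw [Finset.coe_insert]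
      refine Set.Pairwise.insert hI.2 fun u hu _ => ?_
      have := (hcon u hu).2 hy
      exact ⟨fun h => this h.symm, this⟩
    have := hmax (insert y I) ⟨Finset.insert_subset hy hI.1, hind⟩
    rw [Finset.card_insert_of_notMem hyI] at this
    omega
  calc M.card ≤ _ := Finset.card_le_card hcov
    _ ≤ I.card * ((M.filter (G.Adj x)).card + 1) :=
        Finset.card_biUnion_le_card_mul _ _ _ fun u hu =>
          (Finset.card_insert_le _ _).trans (Nat.succ_le_succ (hxmax u (hI.1 hu)))
    _ ≤ _ := Nat.mul_le_mul_right _ (hα I hI.2).le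

/-- A crude form of the Erdős–Szekeres bound. -/
lemma card_le_pow_of_clique_card_le {t : ℕ}
    (hα : ∀ I : Finset V, G.IsIndepSet (I : Set V) → I.card < t) (j : ℕ) (M : Finset V)
    (hM : ∀ K ⊆ M, G.IsClique (K : Set V) → K.card ≤ j) :
    M.card ≤ (2 * t) ^ j := by
  have ht : 0 < t := by simpa using hα ∅ (by simp [IsIndepSet])
  induction j generalizing M with
  | zero =>
    rcases M.eq_empty_or_nonempty with rfl | ⟨x, hx⟩
    · simp
    · have := hM {x} (by simpa using hx) (by simp)
      simp at this
  | succ j ih =>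
    rcases M.eq_empty_or_nonempty with rfl | hne
    · simp
    obtain ⟨x, hx, hcard⟩ := G.exists_card_le_mul_degree hα hne
    have h1 : (M.filter (G.Adj x)).card ≤ (2 * t) ^ j := by
      refine ih _ fun K hK hKc => ?_
      have hxK : x ∉ K := fun h => by simpa using hK h
      have := hM (insert x K)
        (Finset.insert_subset hx (hK.trans (Finset.filter_subset _ _)))
        (by
          rw [Finset.coe_insert]
          exact hKc.insert fun b hb _ => (Finset.mem_filter.1 (hK hb)).2)
      rw [Finset.card_insert_of_notMem hxK] at this
      omega
    have h2 : 1 ≤ (2 * t) ^ j := Nat.one_le_pow _ _ (by omega)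
    calc M.card ≤ t * ((M.filter (G.Adj x)).card + 1) := hcard
      _ ≤ t * ((2 * t) ^ j + (2 * t) ^ j) := by gcongr
      _ = (2 * t) ^ (j + 1) := by ring

/-- Greedy construction of an independent set: if every set `M' ⊆ M` of more than `L` vertices
contains a nonempty independent set whose closed neighbourhood in `M'` is at most `ρ` times larger,
then collecting such sets and deleting their neighbourhoods exhausts all but `L` vertices. -/
lemma exists_isIndepSet_card_le (L ρ : ℕ) (M : Finset V)
    (hM : ∀ M' ⊆ M, L < M'.card → ∃ I ⊆ M', I.Nonempty ∧ G.IsIndepSet (I : Set V) ∧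
      (I ∪ M'.filter fun y => ∃ u ∈ I, G.Adj u y).card ≤ ρ * I.card) :
    ∃ I ⊆ M, G.IsIndepSet (I : Set V) ∧ M.card ≤ L + ρ * I.card := by
  induction M using Finset.strongInduction with
  | H M ih =>
    rcases le_or_gt M.card L with hL | hL
    · exact ⟨∅, by simp, by simp [IsIndepSet], by omega⟩
    obtain ⟨I, hIM, hne, hI, hcard⟩ := hM M subset_rfl hL
    set D := I ∪ M.filter fun y => ∃ u ∈ I, G.Adj u y with hD
    have hDM : D ⊆ M := Finset.union_subset hIM (Finset.filter_subset _ _)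
    have hss : M \ D ⊂ M := by
      refine Finset.sdiff_ssubset hDM (hne.mono Finset.subset_union_left)
    obtain ⟨J, hJ, hJi, hJc⟩ := ih (M \ D) hss fun M' hM' h =>
      hM M' (hM'.trans Finset.sdiff_subset) h
    have hJD : ∀ y ∈ J, y ∈ M ∧ y ∉ D := fun y hy => Finset.mem_sdiff.1 (hJ hy)
    have hdisj : Disjoint I J := by
      rw [Finset.disjoint_left]
      intro y hy hy'
      exact (hJD y hy').2 (Finset.mem_union_left _ hy)
    have hno : ∀ u ∈ I, ∀ y ∈ J, ¬ G.Adj u y := by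
      intro u hu y hy h
      exact (hJD y hy).2 (Finset.mem_union_right _
        (Finset.mem_filter.2 ⟨(hJD y hy).1, u, hu, h⟩))
    refine ⟨I ∪ J, Finset.union_subset hIM (hJ.trans Finset.sdiff_subset), ?_, ?_⟩
    · intro a ha b hb hab
      rw [Finset.mem_coe, Finset.mem_union] at ha hb
      rcases ha with ha | ha <;> rcases hb with hb | hb
      · exact hI ha hb hab
      · exact hno a ha b hb
      · exact fun h => hno b hb a ha h.symm
      · exact hJi ha hb hab
    · rw [Finset.card_union_of_disjoint hdisj, mul_add]
      have := Finset.card_sdiff_add_card_eq_card hDM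
      omega

/-! ### Five-cycles in triangle-free sets -/

/-- In a triangle-free set `M` the neighbourhood `J` of a vertex `v` is independent. If the second
neighbourhood of `v` through `J` is independent as well, it has fewer than `s ^ 2` vertices and `J`
expands badly; so the greedy construction would give an independent set of size `s ^ 2`. The sets
`Z v` of forbidden neighbours are too small to matter. -/
lemma exists_fiveCycle {s : ℕ}
    (hα : ∀ I : Finset V, G.IsIndepSet (I : Set V) → I.card < s ^ 2) (Z : V → Finset V)
    {M : Finset V} (hZ : ∀ v ∈ M, (M.filter (· ∈ Z v)).card ≤ s)
    (htri : ∀ a ∈ M, ∀ b ∈ M, ∀ c ∈ M, G.Adj a b → G.Adj a c → ¬ G.Adj b c)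
    (hM : 6 * s ^ 3 < M.card) :
    ∃ v ∈ M, ∃ x ∈ M, ∃ x' ∈ M, ∃ w ∈ M, ∃ w' ∈ M, G.Adj v x ∧ G.Adj v x' ∧
      x ∉ Z v ∧ x' ∉ Z v ∧ G.Adj x w ∧ G.Adj x' w' ∧ G.Adj w w' := by
  by_contra! hcon
  have hs : 0 < s := by
    have := hα ∅ (by simp [IsIndepSet])
    by_contra h
    obtain rfl : s = 0 := by omega
    simp at this
  obtain ⟨I, -, hI, hcard⟩ := G.exists_isIndepSet_card_le (4 * s ^ 3) (1 + s) M (by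
    intro M' hM' hbig
    obtain ⟨v, hv, hdeg⟩ := G.exists_card_le_mul_degree hα
      (Finset.card_pos.1 (by omega : 0 < M'.card))
    set J := M'.filter fun y => G.Adj v y ∧ y ∉ Z v with hJ
    have hmem : ∀ y ∈ J, y ∈ M ∧ G.Adj v y ∧ y ∉ Z v := fun y hy =>
      ⟨hM' (Finset.mem_filter.1 hy).1, (Finset.mem_filter.1 hy).2⟩
    have hJc : 3 * s ≤ J.card := by
      have h1 : 4 * s < (M'.filter (G.Adj v)).card + 1 := by
        by_contra! h
        have : s ^ 2 * ((M'.filter (G.Adj v)).card + 1) ≤ s ^ 2 * (4 * s) := by gcongr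
        have e : s ^ 2 * (4 * s) = 4 * s ^ 3 := by ring
        omega
      have h2 : M'.filter (G.Adj v) ⊆ J ∪ M.filter (· ∈ Z v) := by
        intro y hy
        rw [Finset.mem_filter] at hy
        by_cases hyZ : y ∈ Z v
        · exact Finset.mem_union_right _ (Finset.mem_filter.2 ⟨hM' hy.1, hyZ⟩)
        · exact Finset.mem_union_left _ (Finset.mem_filter.2 ⟨hy.1, hy.2, hyZ⟩)
      have h3 := (Finset.card_le_card h2).trans (Finset.card_union_le _ _)
      have h4 := hZ v (hM' hv)
      omega
    refine ⟨J, Finset.filter_subset _ _, Finset.card_pos.1 (by omega), ?_, ?_⟩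
    · intro a ha b hb _
      exact htri v (hM' hv) a (hmem a ha).1 b (hmem b hb).1 (hmem a ha).2.1 (hmem b hb).2.1
    · have hS : (M'.filter fun y => ∃ u ∈ J, G.Adj u y).card < s ^ 2 := by
        refine hα _ ?_
        intro a ha b hb _
        rw [Finset.mem_coe, Finset.mem_filter] at ha hb
        obtain ⟨haM, u, hu, hua⟩ := ha
        obtain ⟨hbM, u', hu', hub⟩ := hb
        exact hcon v (hM' hv) u (hmem u hu).1 u' (hmem u' hu').1 a (hM' haM) b (hM' hbM)
          (hmem u hu).2.1 (hmem u' hu').2.1 (hmem u hu).2.2 (hmem u' hu').2.2 hua hub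
      refine (Finset.card_union_le _ _).trans ?_
      nlinarith)
  have h1 := hα I hI
  have h2 : (1 + s) * I.card ≤ (2 * s) * s ^ 2 := Nat.mul_le_mul (by omega) h1.le
  nlinarith

/-- If every vertex is forbidden for at most `s` vertices of `M`, then degrees in large subsets of
`M` are hardly affected by forbidden pairs, and a clique can be grown greedily inside `M`, keeping
a large common neighbourhood `M'`. -/
lemma exists_clique_large_common_nbhd {s : ℕ}
    (hα : ∀ I : Finset V, G.IsIndepSet (I : Set V) → I.card < s ^ 2) (Z : V → Finset V)
    (j : ℕ) {M : Finset V} (hZ : ∀ x ∈ M, (M.filter fun v => x ∈ Z v).card ≤ s)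
    (hM : 6 * 3 ^ j * s ^ (2 * j + 3) < M.card) :
    ∃ Q ⊆ M, Q.card = j ∧ G.IsClique (Q : Set V) ∧ ∃ M' ⊆ M, 6 * s ^ 3 < M'.card ∧
      ∀ y ∈ M', ∀ q ∈ Q, G.Adj q y ∧ q ∉ Z y := by
  induction j generalizing M with
  | zero => exact ⟨∅, by simp, by simp, by simp, M, subset_rfl, by simpa using hM, by simp⟩
  | succ j ih =>
    obtain ⟨x, hx, hdeg⟩ := G.exists_card_le_mul_degree hα
      (Finset.card_pos.1 (by omega : 0 < M.card))
    set M₁ := M.filter fun y => G.Adj x y ∧ x ∉ Z y with hM₁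
    have hsub : M₁ ⊆ M := Finset.filter_subset _ _
    have hcard : 6 * 3 ^ j * s ^ (2 * j + 3) < M₁.card := by
      have h1 : 6 * 3 ^ (j + 1) * s ^ (2 * j + 3) < (M.filter (G.Adj x)).card + 1 := by
        by_contra! h
        have := Nat.mul_le_mul_left (s ^ 2) h
        have e : s ^ 2 * (6 * 3 ^ (j + 1) * s ^ (2 * j + 3)) =
          6 * 3 ^ (j + 1) * s ^ (2 * (j + 1) + 3) := by ring
        omega
      have h2 : M.filter (G.Adj x) ⊆ M₁ ∪ M.filter fun v => x ∈ Z v := by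
        intro y hy
        rw [Finset.mem_filter] at hy
        by_cases hyZ : x ∈ Z y
        · exact Finset.mem_union_right _ (Finset.mem_filter.2 ⟨hy.1, hyZ⟩)
        · exact Finset.mem_union_left _ (Finset.mem_filter.2 ⟨hy.1, hy.2, hyZ⟩)
      have h3 := (Finset.card_le_card h2).trans (Finset.card_union_le _ _)
      have h4 := hZ x hx
      have h5 : s ≤ s ^ (2 * j + 3) := Nat.le_self_pow (by omega) s
      have h6 : 1 ≤ 3 ^ j := Nat.one_le_pow _ _ (by norm_num)
      have h7 : s ^ (2 * j + 3) ≤ 3 ^ j * s ^ (2 * j + 3) := Nat.le_mul_of_pos_left _ h6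
      have e : 6 * 3 ^ (j + 1) * s ^ (2 * j + 3) = 18 * (3 ^ j * s ^ (2 * j + 3)) := by ring
      have e' : 6 * 3 ^ j * s ^ (2 * j + 3) = 6 * (3 ^ j * s ^ (2 * j + 3)) := by ring
      have h8 : 0 < s := by
        have := hα ∅ (by simp [IsIndepSet])
        by_contra h
        obtain rfl : s = 0 := by omega
        simp at this
      omega
    obtain ⟨Q, hQ, hQc, hQq, M', hM', hM'c, hM'Q⟩ := ih (M := M₁)
      (fun y hy => (Finset.card_le_card (Finset.filter_subset_filter _ hsub)).trans
        (hZ y (hsub hy))) hcard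
    have hxQ : x ∉ Q := fun h => by simpa [hM₁] using hQ h
    refine ⟨insert x Q, Finset.insert_subset hx (hQ.trans hsub), ?_, ?_, M', hM'.trans hsub,
      hM'c, ?_⟩
    · rw [Finset.card_insert_of_notMem hxQ, hQc]
    · rw [Finset.coe_insert]
      exact hQq.insert fun b hb _ => (Finset.mem_filter.1 (hQ hb)).2.1
    · intro y hy q hq
      rcases Finset.mem_insert.1 hq with rfl | hq
      · exact (Finset.mem_filter.1 (hM' hy)).2
      · exact hM'Q y hy q hq

end SimpleGraph

/-! ### Clique links -/

namespace SimpleGraph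

variable {V : Type*} [DecidableEq V] (G : SimpleGraph V)

/-- `A` is an `n`-clique joined completely to each of the two distinct vertices `v` and `a`. -/
def CliqueLink (n : ℕ) (A : Finset V) (v a : V) : Prop :=
  A.card = n ∧ G.IsClique (A : Set V) ∧ (∀ x ∈ A, G.Adj v x ∧ G.Adj a x) ∧ v ≠ a

variable {G}

lemma CliqueLink.not_adj {n : ℕ} (hfree : G.CliqueFree (n + 2)) {A : Finset V} {v a : V}
    (h : G.CliqueLink n A v a) : ¬ G.Adj v a := by
  intro hva
  obtain ⟨hc, hA, hadj, -⟩ := h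
  have ha : a ∉ A := fun hx => G.irrefl (hadj a hx).2
  have hv : v ∉ insert a A := by
    rw [Finset.mem_insert, not_or]
    exact ⟨hva.ne, fun hx => G.irrefl (hadj v hx).1⟩
  refine hfree (insert v (insert a A)) ⟨?_, ?_⟩
  · rw [Finset.coe_insert, Finset.coe_insert]
    refine (hA.insert fun b hb _ => (hadj b hb).2).insert ?_
    rintro b (rfl | hb) _
    · exact hva
    · exact (hadj b hb).1
  · rw [Finset.card_insert_of_notMem hv, Finset.card_insert_of_notMem ha, hc]

lemma IsIndepSet.card_inter_le_one {I K : Finset V} (hI : G.IsIndepSet (I : Set V))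
    (hK : G.IsClique (K : Set V)) : (I ∩ K).card ≤ 1 := by
  rw [Finset.card_le_one]
  intro a ha b hb
  rw [Finset.mem_inter] at ha hb
  by_contra hab
  exact hI ha.1 hb.1 hab (hK ha.2 hb.2 hab)

/-- Two disjoint links from `v` whose other ends `a` and `b` are adjacent form a clique blow-up of
a five-cycle: the cliques `A ∪ {a}` and `B ∪ {b}` cover everything but `v`, and the non-neighbours
of `v` are just `a` and `b`, which are adjacent. So there is no independent triple. -/
lemma exists_card_indep_le_two_of_links {n : ℕ} (hfree : G.CliqueFree (n + 2))
    {A B : Finset V} {v a b : V} (hA : G.CliqueLink n A v a) (hB : G.CliqueLink n B v b)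
    (hAB : Disjoint A B) (hab : G.Adj a b) :
    ∃ S : Finset V, S.card = 2 * n + 3 ∧
      ∀ I ⊆ S, G.IsIndepSet (I : Set V) → I.card ≤ 2 := by
  have hva := hA.not_adj hfree
  have hvb := hB.not_adj hfree
  obtain ⟨hAc, hAq, hAadj, hne_a⟩ := hA
  obtain ⟨hBc, hBq, hBadj, hne_b⟩ := hB
  have haA : a ∉ A := fun h => hva (hAadj a h).1
  have haB : a ∉ B := fun h => hva (hBadj a h).1
  have hbA : b ∉ A := fun h => hvb (hAadj b h).1
  have hbB : b ∉ B := fun h => hvb (hBadj b h).1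
  have hvA : v ∉ A := fun h => G.irrefl (hAadj v h).1
  have hvB : v ∉ B := fun h => G.irrefl (hBadj v h).1
  have hdisj : Disjoint (insert a A) (insert b B) := by
    rw [Finset.disjoint_insert_left, Finset.disjoint_insert_right, Finset.mem_insert, not_or]
    exact ⟨⟨hab.ne, haB⟩, hbA, hAB⟩
  have hvS : v ∉ insert a A ∪ insert b B := by
    simp [hne_a, hne_b, hvA, hvB]
  refine ⟨insert v (insert a A ∪ insert b B), ?_, ?_⟩
  · rw [Finset.card_insert_of_notMem hvS, Finset.card_union_of_disjoint hdisj,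
      Finset.card_insert_of_notMem haA, Finset.card_insert_of_notMem hbB, hAc, hBc]
    ring
  · intro I hIS hI
    have h1 : (I ∩ insert a A).card ≤ 1 := hI.card_inter_le_one (by
      rw [Finset.coe_insert]
      exact hAq.insert fun x hx _ => (hAadj x hx).2)
    have h2 : (I ∩ insert b B).card ≤ 1 := hI.card_inter_le_one (by
      rw [Finset.coe_insert]
      exact hBq.insert fun x hx _ => (hBadj x hx).2)
    by_cases hvI : v ∈ I
    · -- no neighbour of `v` lies in `I`, so `I` is contained in `{v, a, b}`
      have hsub : I ⊆ insert v (I ∩ {a, b}) := by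
        intro x hx
        have hnv : ¬ G.Adj v x := fun h => hI hvI hx h.ne h
        have hxS := hIS hx
        simp only [Finset.mem_insert, Finset.mem_union, Finset.mem_inter,
          Finset.mem_singleton] at hxS ⊢
        rcases hxS with h | (h | h) | (h | h)
        · exact Or.inl h
        · exact Or.inr ⟨hx, Or.inl h⟩
        · exact absurd (hAadj x h).1 hnv
        · exact Or.inr ⟨hx, Or.inr h⟩
        · exact absurd (hBadj x h).1 hnv
      have h3 : (I ∩ {a, b}).card ≤ 1 := hI.card_inter_le_one (by
        rw [Finset.coe_pair]
        exact (isClique_pair).2 fun _ => hab)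
      have := (Finset.card_le_card hsub).trans (Finset.card_insert_le _ _)
      omega
    · have hsub : I ⊆ (I ∩ insert a A) ∪ (I ∩ insert b B) := by
        intro x hx
        rcases Finset.mem_insert.1 (hIS hx) with rfl | h
        · exact absurd hx hvI
        · rw [← Finset.inter_union_distrib_left]
          exact Finset.mem_inter.2 ⟨hx, h⟩
      have := (Finset.card_le_card hsub).trans (Finset.card_union_le _ _)
      omega

lemma cliqueLink_insert {n : ℕ} {Q : Finset V} (hQc : Q.card = n) (hQ : G.IsClique (Q : Set V))
    {v x w : V} (hv : ∀ q ∈ Q, G.Adj q v) (hx : ∀ q ∈ Q, G.Adj q x) (hw : ∀ q ∈ Q, G.Adj q w)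
    (hvx : G.Adj v x) (hxw : G.Adj x w) (hvw : v ≠ w) :
    G.CliqueLink (n + 1) (insert x Q) v w := by
  have hxQ : x ∉ Q := fun h => G.irrefl (hx x h)
  refine ⟨by rw [Finset.card_insert_of_notMem hxQ, hQc], ?_, ?_, hvw⟩
  · rw [Finset.coe_insert]
    exact hQ.insert fun b hb _ => (hx b hb).symm
  · intro y hy
    rcases Finset.mem_insert.1 hy with rfl | hy
    · exact ⟨hvx, hxw.symm⟩
    · exact ⟨(hv y hy).symm, (hw y hy).symm⟩

lemma CliqueFree.not_triangle_of_common_nbhd {n : ℕ} (hfree : G.CliqueFree (n + 3))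
    {Q : Finset V} (hQc : Q.card = n) (hQ : G.IsClique (Q : Set V)) {a b c : V}
    (ha : ∀ q ∈ Q, G.Adj q a) (hb : ∀ q ∈ Q, G.Adj q b) (hc : ∀ q ∈ Q, G.Adj q c)
    (hab : G.Adj a b) (hac : G.Adj a c) : ¬ G.Adj b c := by
  intro hbc
  exact (cliqueLink_insert hQc hQ hb ha hc hab.symm hac hbc.ne).not_adj
    hfree hbc

variable (G)

/-- A set `P` of at most `n + 1` neighbours of `v` that contains two links, not necessarily
disjoint, from `v` to the two ends of an edge. The relevant example is a five-cycle through `v`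
joined to an `(n - 1)`-clique `Q`, with `P` made of `Q` and the neighbours of `v` on the cycle. -/
def IsLinkedPair (n : ℕ) (v : V) (P : Finset V) : Prop :=
  P.card ≤ n + 1 ∧ (∀ p ∈ P, G.Adj v p) ∧ ∃ A ⊆ P, ∃ B ⊆ P, ∃ w w' : V,
    G.CliqueLink n A v w ∧ G.CliqueLink n B v w' ∧ G.Adj w w'

variable {G}

/-- In pairwise disjoint linked pairs at `v`, the ends `w` of the first links are distinct and
pairwise non-adjacent, by the absence of disjoint links to adjacent vertices. Hence there are fewer
than `t` of them. -/
lemma card_lt_of_pairwiseDisjoint_isLinkedPair {n t : ℕ} (hfree : G.CliqueFree (n + 2))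
    (hloc : ∀ S : Finset V, S.card = 2 * n + 3 →
      ∃ I ⊆ S, G.IsIndepSet (I : Set V) ∧ 2 < I.card)
    (hα : ∀ I : Finset V, G.IsIndepSet (I : Set V) → I.card < t) {v : V}
    {F : Finset (Finset V)} (hF : ∀ P ∈ F, G.IsLinkedPair n v P)
    (hdisj : (F : Set (Finset V)).PairwiseDisjoint id) : F.card < t := by
  have key : ∀ A B : Finset V, ∀ a b : V, G.CliqueLink n A v a → G.CliqueLink n B v b →
      Disjoint A B → ¬ G.Adj a b := by
    intro A B a b hA hB hAB hab
    obtain ⟨S, hS, hSI⟩ := exists_card_indep_le_two_of_links hfree hA hB hAB hab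
    obtain ⟨I, hI, hIi, hIc⟩ := hloc S hS
    exact absurd (hSI I hI hIi) (by omega)
  have : Nonempty V := ⟨v⟩
  choose! A hA B hB w w' hw hw' hadj using fun P hP => (hF P hP).2.2
  have hinj : Set.InjOn w (F : Set (Finset V)) := by
    intro P hP P' hP' heq
    by_contra hne
    have hd : Disjoint P P' := hdisj hP hP' hne
    refine key (B P) (A P') (w' P) (w P') (hw' P hP) (hw P' hP')
      (hd.mono (hB P hP) (hA P' hP')) ?_
    rw [← heq]
    exact (hadj P hP).symm
  rw [← Finset.card_image_of_injOn hinj]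
  refine hα _ ?_
  rw [Finset.coe_image]
  rintro _ ⟨P, hP, rfl⟩ _ ⟨P', hP', rfl⟩ hne
  have hd : Disjoint P P' := hdisj hP hP' fun h => hne (by rw [h])
  exact key (A P) (A P') (w P) (w P') (hw P hP) (hw P' hP') (hd.mono (hA P hP) (hA P' hP'))

/-- The union `Z` of a maximal disjoint family of linked pairs at `v` meets every linked pair. -/
lemma exists_small_transversal [Fintype V] {n t : ℕ} (hn : 0 < n)
    (hfree : G.CliqueFree (n + 2))
    (hloc : ∀ S : Finset V, S.card = 2 * n + 3 →
      ∃ I ⊆ S, G.IsIndepSet (I : Set V) ∧ 2 < I.card)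
    (hα : ∀ I : Finset V, G.IsIndepSet (I : Set V) → I.card < t) (v : V) :
    ∃ Z : Finset V, Z.card ≤ (n + 1) * t ∧ (∀ z ∈ Z, G.Adj v z) ∧
      ∀ P, G.IsLinkedPair n v P → ¬ Disjoint P Z := by
  classical
  obtain ⟨F, hF, hmax⟩ := Finset.exists_max_image
    ((Finset.univ : Finset (Finset (Finset V))).filter fun F : Finset (Finset V) =>
      (∀ P ∈ F, G.IsLinkedPair n v P) ∧ (F : Set (Finset V)).PairwiseDisjoint id)
    Finset.card ⟨∅, by simp⟩
  simp only [Finset.mem_filter, Finset.mem_univ, true_and] at hF hmax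
  refine ⟨F.biUnion id, ?_, ?_, ?_⟩
  · calc (F.biUnion id).card ≤ F.card * (n + 1) :=
          Finset.card_biUnion_le_card_mul _ _ _ fun P hP => (hF.1 P hP).1
      _ ≤ t * (n + 1) := Nat.mul_le_mul_right _
          (card_lt_of_pairwiseDisjoint_isLinkedPair hfree hloc hα hF.1 hF.2).le
      _ = _ := mul_comm _ _
  · intro z hz
    obtain ⟨P, hP, hzP⟩ := Finset.mem_biUnion.1 hz
    exact (hF.1 P hP).2.1 z hzP
  · intro P hP hdis
    have hPF : ∀ P' ∈ F, Disjoint P P' := fun P' hP' =>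
      hdis.mono_right (Finset.subset_biUnion_of_mem id hP')
    have hnot : P ∉ F := by
      intro hmem
      have hempty := Finset.disjoint_self_iff_empty P |>.1 (hPF P hmem)
      obtain ⟨A, hA, _, _, _, _, hl, -⟩ := hP.2.2
      rw [hempty, Finset.subset_empty] at hA
      have := hl.1
      rw [hA, Finset.card_empty] at this
      omega
    have := hmax (insert P F) ⟨by
      intro P' hP'
      rcases Finset.mem_insert.1 hP' with rfl | h
      · exact hP
      · exact hF.1 P' h, by
      rw [Finset.coe_insert]
      exact hF.2.insert fun P' hP' _ => hPF P' hP'⟩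
    rw [Finset.card_insert_of_notMem hnot] at this
    omega

end SimpleGraph

/-! ### Finding a linked pair that avoids a small set -/

namespace SimpleGraph

variable {V : Type*} [DecidableEq V] [Fintype V] (G : SimpleGraph V) [DecidableRel G.Adj]

/-- Call `(v, z)` an arc if `z ∈ Z v`. If arcs are few and the ends of an arc have few common
neighbours, then most neighbourhoods contain few arcs. Averaging over the vertices and discarding
exceptional ones leaves, inside some neighbourhood, a large set `M` in which all in-degrees and
out-degrees are at most `s`. -/
lemma exists_nbhd_few_arcs [Nonempty V] {t : ℕ}
    (hα : ∀ I : Finset V, G.IsIndepSet (I : Set V) → I.card < t) (Z : V → Finset V) {D E : ℕ}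
    (hD : 0 < D) (hE : 0 < E) (hZ : ∀ v, (Z v).card ≤ D)
    (hcodeg : ∀ v, ∀ z ∈ Z v, (Finset.univ.filter fun x => G.Adj x v ∧ G.Adj x z).card ≤ E)
    (s : ℕ) :
    ∃ x, ∃ M : Finset V, (∀ y ∈ M, G.Adj x y ∧ x ∉ Z y) ∧
      (∀ v ∈ M, (M.filter (· ∈ Z v)).card ≤ s) ∧
      (∀ z ∈ M, (M.filter fun v => z ∈ Z v).card ≤ s) ∧
      s * Fintype.card V ≤ 2 * t * (s * (M.card + 4 * D + 1) + 8 * (D * E)) := by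
  classical
  set N := Fintype.card V with hN
  let inDeg : V → ℕ := fun x => (Finset.univ.filter fun v => x ∈ Z v).card
  let arcs : V → ℕ := fun x => ∑ v, ((Z v).filter fun z => G.Adj x v ∧ G.Adj x z).card
  have hin : ∑ x, inDeg x ≤ N * D := by
    calc ∑ x, inDeg x = ∑ v, (Z v).card := by
          simp only [inDeg, Finset.card_filter]
          rw [Finset.sum_comm]
          refine Finset.sum_congr rfl fun v _ => ?_
          rw [← Finset.card_filter]
          congr 1
          ext x
          simp
      _ ≤ ∑ _v : V, D := Finset.sum_le_sum fun v _ => hZ v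
      _ = N * D := by simp [hN]
  have harcs : ∑ x, arcs x ≤ N * (D * E) := by
    calc ∑ x, arcs x
        = ∑ v, ∑ z ∈ Z v, (Finset.univ.filter fun x => G.Adj x v ∧ G.Adj x z).card := by
          simp only [arcs, Finset.card_filter]
          rw [Finset.sum_comm]
          exact Finset.sum_congr rfl fun v _ => Finset.sum_comm
      _ ≤ ∑ v, ∑ _z ∈ Z v, E :=
          Finset.sum_le_sum fun v _ => Finset.sum_le_sum fun z hz => hcodeg v z hz
      _ ≤ ∑ _v : V, D * E := by
          refine Finset.sum_le_sum fun v _ => ?_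
          rw [Finset.sum_const, smul_eq_mul]
          exact Nat.mul_le_mul_right _ (hZ v)
      _ = N * (D * E) := by simp [hN]
  -- one cost function controls both quantities
  set good := Finset.univ.filter fun x => inDeg x * E + arcs x ≤ 4 * (D * E) with hgood
  have hgoodc : N ≤ 2 * good.card := by
    set bad := Finset.univ.filter fun x => ¬ inDeg x * E + arcs x ≤ 4 * (D * E) with hbad
    have h1 : bad.card * (4 * (D * E)) ≤ 2 * N * (D * E) := by
      calc bad.card * (4 * (D * E)) = ∑ _x ∈ bad, 4 * (D * E) := by simp
        _ ≤ ∑ x ∈ bad, (inDeg x * E + arcs x) :=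
            Finset.sum_le_sum fun x hx => (not_le.1 (Finset.mem_filter.1 hx).2).le
        _ ≤ ∑ x, (inDeg x * E + arcs x) :=
            Finset.sum_le_sum_of_subset (Finset.subset_univ _)
        _ = (∑ x, inDeg x) * E + ∑ x, arcs x := by
            rw [Finset.sum_add_distrib, Finset.sum_mul]
        _ ≤ (N * D) * E + N * (D * E) := by gcongr
        _ = 2 * N * (D * E) := by ring
    have h2 : good.card + bad.card = N := by
      rw [hgood, hbad, Finset.card_filter_add_card_filter_not, Finset.card_univ]
    have h3 : bad.card * 4 ≤ 2 * N := by
      have hpos : 0 < D * E := Nat.mul_pos hD hE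
      refine Nat.le_of_mul_le_mul_right ?_ hpos
      linarith
    omega
  have hNpos : 0 < N := Fintype.card_pos
  obtain ⟨x, hx, hdeg⟩ := G.exists_card_le_mul_degree hα
    (Finset.card_pos.1 (by omega : 0 < good.card))
  have hxcost := (Finset.mem_filter.1 hx).2
  have hxin : inDeg x ≤ 4 * D := by
    refine Nat.le_of_mul_le_mul_right (c := E) ?_ hE
    linarith
  have hxarcs : arcs x ≤ 4 * (D * E) := by omega
  set M₁ := good.filter fun y => G.Adj x y ∧ x ∉ Z y with hM₁
  have hM₁mem : ∀ y ∈ M₁, G.Adj x y ∧ x ∉ Z y := fun y hy => (Finset.mem_filter.1 hy).2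
  have hdegM₁ : (good.filter (G.Adj x)).card ≤ M₁.card + 4 * D := by
    have hsub : good.filter (G.Adj x) ⊆ M₁ ∪ Finset.univ.filter fun v => x ∈ Z v := by
      intro y hy
      rw [Finset.mem_filter] at hy
      by_cases hyZ : x ∈ Z y
      · exact Finset.mem_union_right _ (by simpa using hyZ)
      · exact Finset.mem_union_left _ (Finset.mem_filter.2 ⟨hy.1, hy.2, hyZ⟩)
    exact (Finset.card_le_card hsub).trans ((Finset.card_union_le _ _).trans (by gcongr))
  let deg : V → ℕ := fun v => (M₁.filter (· ∈ Z v)).card + (M₁.filter fun u => v ∈ Z u).card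
  have hdegsum : ∑ v ∈ M₁, deg v ≤ 8 * (D * E) := by
    have hout : ∑ v ∈ M₁, (M₁.filter (· ∈ Z v)).card ≤ arcs x := by
      calc _ ≤ ∑ v ∈ M₁, ((Z v).filter fun z => G.Adj x v ∧ G.Adj x z).card := by
            refine Finset.sum_le_sum fun v hv => Finset.card_le_card fun z hz => ?_
            rw [Finset.mem_filter] at hz ⊢
            exact ⟨hz.2, (hM₁mem v hv).1, (hM₁mem z hz.1).1⟩
        _ ≤ _ := Finset.sum_le_sum_of_subset (Finset.subset_univ _)
    have hinout : ∑ v ∈ M₁, (M₁.filter fun u => v ∈ Z u).card =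
        ∑ v ∈ M₁, (M₁.filter (· ∈ Z v)).card := by
      simp only [Finset.card_filter]
      exact Finset.sum_comm
    have : ∑ v ∈ M₁, deg v = _ := Finset.sum_add_distrib
    omega
  set M := M₁.filter fun v => deg v ≤ s with hM
  have hMsub : M ⊆ M₁ := Finset.filter_subset _ _
  have hMbad : s * M₁.card ≤ s * M.card + 8 * (D * E) := by
    have h1 : (M₁.filter fun v => ¬ deg v ≤ s).card * s ≤ ∑ v ∈ M₁, deg v := by
      calc _ = ∑ _v ∈ M₁.filter (fun v => ¬ deg v ≤ s), s := by simp
        _ ≤ ∑ v ∈ M₁.filter (fun v => ¬ deg v ≤ s), deg v :=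
            Finset.sum_le_sum fun v hv => (not_le.1 (Finset.mem_filter.1 hv).2).le
        _ ≤ _ := Finset.sum_le_sum_of_subset (Finset.filter_subset _ _)
    have h2 : M.card + (M₁.filter fun v => ¬ deg v ≤ s).card = M₁.card := by
      rw [hM, Finset.card_filter_add_card_filter_not]
    rw [← h2]
    linarith
  refine ⟨x, M, fun y hy => hM₁mem y (hMsub hy), fun v hv => ?_, fun z hz => ?_, ?_⟩
  · have h1 := (Finset.mem_filter.1 hv).2
    have h2 : (M.filter (· ∈ Z v)).card ≤ (M₁.filter (· ∈ Z v)).card :=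
      Finset.card_le_card (Finset.filter_subset_filter _ hMsub)
    have h3 : deg v = (M₁.filter (· ∈ Z v)).card + (M₁.filter fun u => v ∈ Z u).card := rfl
    omega
  · have h1 := (Finset.mem_filter.1 hz).2
    have h2 : (M.filter fun v => z ∈ Z v).card ≤ (M₁.filter fun v => z ∈ Z v).card :=
      Finset.card_le_card (Finset.filter_subset_filter _ hMsub)
    have h3 : deg z = (M₁.filter (· ∈ Z z)).card + (M₁.filter fun u => z ∈ Z u).card := rfl
    omega
  · calc s * N ≤ s * (2 * (t * (M₁.card + 4 * D + 1))) := by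
          gcongr
          refine hgoodc.trans ?_
          gcongr
          refine hdeg.trans ?_
          gcongr
      _ = 2 * t * (s * M₁.card + s * (4 * D + 1)) := by ring
      _ ≤ 2 * t * ((s * M.card + 8 * (D * E)) + s * (4 * D + 1)) := by gcongr
      _ = _ := by ring

end SimpleGraph

namespace SimpleGraph

/-- The triangle-free case: a five-cycle is itself made of two disjoint links to adjacent
vertices. -/
lemma exists_locally_dense_of_triangleFree {V : Type*} [Fintype V] [DecidableEq V]
    {G : SimpleGraph V} [DecidableRel G.Adj] {s : ℕ} (hfree : G.CliqueFree 3)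
    (hα : ∀ I : Finset V, G.IsIndepSet (I : Set V) → I.card < s ^ 2)
    (hcard : 6 * s ^ 3 < Fintype.card V) :
    ∃ S : Finset V, S.card = 5 ∧ ∀ I ⊆ S, G.IsIndepSet (I : Set V) → I.card ≤ 2 := by
  have htri : ∀ a b c, G.Adj a b → G.Adj a c → ¬ G.Adj b c := fun a b c hab hac =>
    CliqueFree.not_triangle_of_common_nbhd (n := 0) (Q := ∅) hfree rfl (by simp)
      (by simp) (by simp) (by simp) hab hac
  obtain ⟨v, -, x, -, x', -, w, -, w', -, hvx, hvx', -, -, hxw, hxw', hww⟩ :=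
    G.exists_fiveCycle hα (fun _ => ∅) (M := Finset.univ) (by simp)
      (fun a _ b _ c _ => htri a b c) (by simpa using hcard)
  have hvw : v ≠ w := by
    rintro rfl
    exact htri x' v w' hvx'.symm hxw' hww
  have hvw' : v ≠ w' := by
    rintro rfl
    exact htri x v w hvx.symm hxw hww.symm
  have hxx' : x ≠ x' := by
    rintro rfl
    exact htri x w w' hxw hxw' hww
  have h1 := cliqueLink_insert (G := G) (Q := ∅) rfl (by simp) (by simp) (by simp) (by simp)
    hvx hxw hvw
  have h2 := cliqueLink_insert (G := G) (Q := ∅) rfl (by simp) (by simp) (by simp) (by simp)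
    hvx' hxw' hvw'
  exact exists_card_indep_le_two_of_links (n := 1) hfree h1 h2 (by simpa using hxx') hww

/-- The case of `K_{j + 4}`-free graphs. Inside a neighbourhood with few arcs one finds a clique
`Q` and a five-cycle joined to it such that the corresponding linked pair at a vertex `v` of the
cycle avoids the transversal of all linked pairs at `v`. -/
lemma exists_locally_dense_of_cliqueFree {V : Type*} [Fintype V] [DecidableEq V]
    {G : SimpleGraph V} [DecidableRel G.Adj] {s j : ℕ} (hfree : G.CliqueFree (j + 4))
    (hα : ∀ I : Finset V, G.IsIndepSet (I : Set V) → I.card < s ^ 2)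
    (hcard : 2 * (6 * 3 ^ j + 4 * (j + 3) + 1 + 8 * (j + 3) * 2 ^ (j + 1)) * s ^ (2 * j + 5) <
      Fintype.card V) :
    ∃ S : Finset V, S.card = 2 * (j + 2) + 3 ∧
      ∀ I ⊆ S, G.IsIndepSet (I : Set V) → I.card ≤ 2 := by
  by_contra! hloc
  have hs : 0 < s := by
    have := hα ∅ (by simp [IsIndepSet])
    by_contra h
    obtain rfl : s = 0 := by omega
    simp at this
  have : Nonempty V := Fintype.card_pos_iff.1 (by omega)
  choose Z hZc hZadj hZ using
    exists_small_transversal (n := j + 2) (by omega) hfree hloc hα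
  have hcodeg : ∀ v, ∀ z ∈ Z v,
      (Finset.univ.filter fun x => G.Adj x v ∧ G.Adj x z).card ≤ (2 * s ^ 2) ^ (j + 1) := by
    intro v z hz
    refine G.card_le_pow_of_clique_card_le hα _ _ fun K hK hKq => ?_
    by_contra! hlt
    obtain ⟨Q, hQK, hQc⟩ := Finset.exists_subset_card_eq (show j + 2 ≤ K.card by omega)
    have hadj : ∀ q ∈ Q, G.Adj q v ∧ G.Adj q z := fun q hq =>
      (Finset.mem_filter.1 (hK (hQK hq))).2
    have hlink : G.CliqueLink (j + 2) Q v z :=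
      ⟨hQc, hKq.subset (by exact_mod_cast hQK),
        fun q hq => ⟨(hadj q hq).1.symm, (hadj q hq).2.symm⟩, (hZadj v z hz).ne⟩
    exact hlink.not_adj hfree (hZadj v z hz)
  obtain ⟨x, M, hxM, hout, hin, hMcard⟩ :=
    G.exists_nbhd_few_arcs hα Z (D := (j + 2 + 1) * s ^ 2) (E := (2 * s ^ 2) ^ (j + 1))
      (by positivity) (by positivity) hZc hcodeg s
  have hMbig : 6 * 3 ^ j * s ^ (2 * j + 3) < M.card := by
    by_contra! hle
    have h1 : s * Fintype.card V ≤
        s * (2 * (6 * 3 ^ j + 4 * (j + 3) + 1 + 8 * (j + 3) * 2 ^ (j + 1)) *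
          s ^ (2 * j + 5)) := by
      have e1 : s ^ 2 ≤ s ^ (2 * j + 3) := Nat.pow_le_pow_right hs (by omega)
      have e2 : 1 ≤ s ^ (2 * j + 3) := Nat.one_le_pow _ _ hs
      calc s * Fintype.card V ≤ _ := hMcard
        _ ≤ 2 * s ^ 2 * (s * (6 * 3 ^ j * s ^ (2 * j + 3) +
              4 * ((j + 2 + 1) * s ^ (2 * j + 3)) + s ^ (2 * j + 3)) +
              8 * ((j + 2 + 1) * s ^ 2 * (2 * s ^ 2) ^ (j + 1))) := by gcongr
        _ = _ := by
          rw [mul_pow]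
          ring
    exact absurd (Nat.le_of_mul_le_mul_left h1 hs) (by omega)
  obtain ⟨Q, hQM, hQc, hQq, M', hM'M, hM'c, hM'Q⟩ :=
    G.exists_clique_large_common_nbhd hα Z j hin hMbig
  -- adding `x` to `Q` completes the clique to which the five-cycle is joined
  have hxQ : x ∉ Q := fun h => G.irrefl (hxM x (hQM h)).1
  set R := insert x Q with hR
  have hRc : R.card = j + 1 := by rw [hR, Finset.card_insert_of_notMem hxQ, hQc]
  have hRq : G.IsClique (R : Set V) := by
    rw [hR, Finset.coe_insert]
    exact hQq.insert fun b hb _ => (hxM b (hQM hb)).1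
  have hRM : ∀ y ∈ M', ∀ q ∈ R, G.Adj q y ∧ q ∉ Z y := by
    intro y hy q hq
    rcases Finset.mem_insert.1 hq with rfl | hq
    · exact hxM y (hM'M hy)
    · exact hM'Q y hy q hq
  have hRa : ∀ y ∈ M', ∀ q ∈ R, G.Adj q y := fun y hy q hq => (hRM y hy q hq).1
  have htri : ∀ a ∈ M', ∀ b ∈ M', ∀ c ∈ M', G.Adj a b → G.Adj a c → ¬ G.Adj b c :=
    fun a ha b hb c hc => CliqueFree.not_triangle_of_common_nbhd hfree hRc hRq
      (hRa a ha) (hRa b hb) (hRa c hc)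
  obtain ⟨v, hv, y, hy, y', hy', w, hw, w', hw', hvy, hvy', hyZ, hyZ', hyw, hyw', hww⟩ :=
    G.exists_fiveCycle hα Z (M := M')
      (fun v hv => (Finset.card_le_card (Finset.filter_subset_filter _ hM'M)).trans
        (hout v (hM'M hv))) htri hM'c
  have hvw : v ≠ w := by
    rintro rfl
    exact htri y' hy' v hv w' hw' hvy'.symm hyw' hww
  have hvw' : v ≠ w' := by
    rintro rfl
    exact htri y hy v hv w hw hvy.symm hyw hww.symm
  refine hZ v (insert y (insert y' R)) ⟨?_, ?_, insert y R, ?_, insert y' R, ?_, w, w',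
    cliqueLink_insert hRc hRq (hRa v hv) (hRa y hy) (hRa w hw) hvy hyw hvw,
    cliqueLink_insert hRc hRq (hRa v hv) (hRa y' hy') (hRa w' hw') hvy' hyw' hvw', hww⟩ ?_
  · have h1 := Finset.card_insert_le y (insert y' R)
    have h2 := Finset.card_insert_le y' R
    omega
  · intro p hp
    rcases Finset.mem_insert.1 hp with rfl | hp
    · exact hvy
    rcases Finset.mem_insert.1 hp with rfl | hp
    · exact hvy'
    · exact (hRa v hv p hp).symm
  · exact Finset.insert_subset_insert _ (Finset.subset_insert _ _)
  · exact Finset.subset_insert _ _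
  · rw [Finset.disjoint_insert_left, Finset.disjoint_insert_left]
    exact ⟨hyZ, hyZ', Finset.disjoint_left.2 fun q hq => (hRM v hv q hq).2⟩

/-! ### Locally dense sets in graphs with small independence number -/

/-- A graph on more than `C * s ^ (2 * n + 1)` vertices without independent sets of size `s ^ 2`
has `2 * n + 3` vertices among which there is no independent triple. If there is a clique of size
`n + 2`, it can be combined with a clique of size `n + 1` in its complement. -/
lemma exists_locally_dense (n : ℕ) (hn : 0 < n) :
    ∃ C : ℕ, ∀ (V : Type*) [Fintype V] (G : SimpleGraph V) (s : ℕ),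
      (∀ I : Finset V, G.IsIndepSet (I : Set V) → I.card < s ^ 2) →
      C * s ^ (2 * n + 1) < Fintype.card V →
      ∃ S : Finset V, S.card = 2 * n + 3 ∧
        ∀ I ⊆ S, G.IsIndepSet (I : Set V) → I.card ≤ 2 := by
  obtain ⟨C, hC⟩ : ∃ C : ℕ, ∀ (V : Type _) [Fintype V] (G : SimpleGraph V) (s : ℕ),
      G.CliqueFree (n + 2) →
      (∀ I : Finset V, G.IsIndepSet (I : Set V) → I.card < s ^ 2) →
      C * s ^ (2 * n + 1) < Fintype.card V →
      ∃ S : Finset V, S.card = 2 * n + 3 ∧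
        ∀ I ⊆ S, G.IsIndepSet (I : Set V) → I.card ≤ 2 := by
    classical
    rcases n with _ | _ | j
    · omega
    · exact ⟨6, fun V _ G s hfree hα hcard =>
        exists_locally_dense_of_triangleFree hfree hα hcard⟩
    · exact ⟨_, fun V _ G s hfree hα hcard =>
        exists_locally_dense_of_cliqueFree hfree hα hcard⟩
  refine ⟨C + (n + 2) + 2 ^ n, fun V _ G s hα hcard => ?_⟩
  classical
  have hs : 0 < s := by
    have := hα ∅ (by simp [IsIndepSet])
    by_contra h
    obtain rfl : s = 0 := by omega
    simp at this
  rw [add_mul, add_mul] at hcard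
  by_cases hfree : G.CliqueFree (n + 2)
  · exact hC V G s hfree hα (by omega)
  obtain ⟨K, hK⟩ : ∃ K, G.IsNClique (n + 2) K := by simpa [CliqueFree] using hfree
  obtain ⟨L, hL, hLq, hLc⟩ : ∃ L ⊆ Kᶜ, G.IsClique (L : Set V) ∧ n < L.card := by
    by_contra! hcon
    have h1 := G.card_le_pow_of_clique_card_le hα n Kᶜ hcon
    have h2 : (2 * s ^ 2) ^ n ≤ 2 ^ n * s ^ (2 * n + 1) := by
      rw [mul_pow, ← pow_mul]
      exact Nat.mul_le_mul_left _ (Nat.pow_le_pow_right hs (by omega))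
    have h3 : n + 2 ≤ (n + 2) * s ^ (2 * n + 1) :=
      Nat.le_mul_of_pos_right _ (Nat.pow_pos hs)
    have h4 := Finset.card_add_card_compl K
    have h5 := hK.card_eq
    omega
  obtain ⟨L', hL', hL'c⟩ := Finset.exists_subset_card_eq (show n + 1 ≤ L.card by omega)
  have hdisj : Disjoint K L' := by
    rw [Finset.disjoint_left]
    intro y hy hy'
    exact Finset.mem_compl.1 (hL (hL' hy')) hy
  refine ⟨K ∪ L', ?_, fun I hI hIi => ?_⟩
  · rw [Finset.card_union_of_disjoint hdisj, hK.card_eq, hL'c]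
    ring
  · have h1 := hIi.card_inter_le_one hK.isClique
    have h2 := hIi.card_inter_le_one (hLq.subset (by exact_mod_cast hL') :
      G.IsClique (L' : Set V))
    have h3 : I ⊆ (I ∩ K) ∪ (I ∩ L') := by
      rw [← Finset.inter_union_distrib_left]
      exact Finset.subset_inter subset_rfl hI
    have := (Finset.card_le_card h3).trans (Finset.card_union_le _ _)
    omega

end SimpleGraph

/-! ### From locally dense sets to the local independence number -/

namespace SimpleGraph

/-- Disjoint locally dense sets can be found one after the other in the remaining vertices `U`. -/
lemma exists_union_locally_dense (n : ℕ) (hn : 0 < n) :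
    ∃ C : ℕ, ∀ (V : Type*) [Fintype V] [DecidableEq V] (G : SimpleGraph V) (s : ℕ),
      (∀ I : Finset V, G.IsIndepSet (I : Set V) → I.card < s ^ 2) →
      ∀ (p : ℕ) (U : Finset V), C * s ^ (2 * n + 1) + p * (2 * n + 3) < U.card →
      ∃ S ⊆ U, S.card = p * (2 * n + 3) ∧
        ∀ I ⊆ S, G.IsIndepSet (I : Set V) → I.card ≤ 2 * p := by
  obtain ⟨C, hC⟩ := exists_locally_dense n hn
  refine ⟨C, fun V _ _ G s hα p U hU => ?_⟩
  induction p generalizing U with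
  | zero =>
    refine ⟨∅, by simp, by simp, fun I hI _ => ?_⟩
    simp [Finset.subset_empty.1 hI]
  | succ p ih =>
    obtain ⟨T, hTc, hT⟩ := hC U (G.induce (U : Set V)) s (fun I hI => by
      have := hα (I.map (Function.Embedding.subtype _)) (by
        intro a ha b hb hab hadj
        simp only [Finset.coe_map, Set.mem_image, Finset.mem_coe] at ha hb
        obtain ⟨a, ha, rfl⟩ := ha
        obtain ⟨b, hb, rfl⟩ := hb
        exact hI ha hb (fun h => hab (by rw [h])) hadj)
      simpa using this) (by
        rw [Fintype.card_coe]
        nlinarith)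
    set T' : Finset V := T.map (Function.Embedding.subtype _) with hT'
    have hT'U : T' ⊆ U := by
      intro y hy
      obtain ⟨z, -, rfl⟩ := Finset.mem_map.1 hy
      exact z.2
    have hT'c : T'.card = 2 * n + 3 := by rw [hT', Finset.card_map, hTc]
    have hT'I : ∀ I ⊆ T', G.IsIndepSet (I : Set V) → I.card ≤ 2 := by
      intro I hI hIi
      obtain ⟨J, hJ, rfl⟩ := Finset.subset_map_iff.1 hI
      rw [Finset.card_map]
      refine hT J hJ fun a ha b hb hab hadj => ?_
      exact hIi (Finset.mem_coe.2 (Finset.mem_map_of_mem _ ha))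
        (Finset.mem_coe.2 (Finset.mem_map_of_mem _ hb)) (fun h => hab (Subtype.ext h)) hadj
    have hcard := Finset.card_sdiff_add_card_eq_card hT'U
    obtain ⟨S, hS, hSc, hSI⟩ := ih (U \ T') (by
      rw [add_mul] at hU
      omega)
    have hdisj : Disjoint T' S :=
      Finset.disjoint_left.2 fun y hy hy' => (Finset.mem_sdiff.1 (hS hy')).2 hy
    refine ⟨T' ∪ S, Finset.union_subset hT'U (hS.trans Finset.sdiff_subset), ?_, ?_⟩
    · rw [Finset.card_union_of_disjoint hdisj, hT'c, hSc]
      ring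
    · intro I hI hIi
      have h1 := hT'I (I ∩ T') Finset.inter_subset_right
        (hIi.mono (by simp))
      have h2 := hSI (I ∩ S) Finset.inter_subset_right
        (hIi.mono (by simp))
      have h3 : I ⊆ (I ∩ T') ∪ (I ∩ S) := by
        rw [← Finset.inter_union_distrib_left]
        exact Finset.subset_inter subset_rfl hI
      have := (Finset.card_le_card h3).trans (Finset.card_union_le _ _)
      omega

/-- If `2 * m ≤ (2 * n + 3) * q`, a graph on many vertices has `m` vertices among which there are
at most `q` independent ones: take `q / 2` disjoint locally dense sets and, for odd `q`, a clique of
size `n + 1`. -/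
lemma exists_card_eq_indep_le (n m q : ℕ) (hn : 0 < n) (hm : 2 * m ≤ (2 * n + 3) * q) :
    ∃ C : ℕ, ∀ (V : Type*) [Fintype V] (G : SimpleGraph V) (s : ℕ),
      (∀ I : Finset V, G.IsIndepSet (I : Set V) → I.card < s ^ 2) →
      C * s ^ (2 * n + 1) < Fintype.card V →
      ∃ S : Finset V, S.card = m ∧ ∀ I ⊆ S, G.IsIndepSet (I : Set V) → I.card ≤ q := by
  classical
  obtain ⟨C, hC⟩ := exists_union_locally_dense n hn
  refine ⟨C + q * (2 * n + 3) + 2 ^ n, fun V _ G s hα hcard => ?_⟩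
  have hs : 0 < s := by
    have := hα ∅ (by simp [IsIndepSet])
    by_contra h
    obtain rfl : s = 0 := by omega
    simp at this
  have hpow : 0 < s ^ (2 * n + 1) := Nat.pow_pos hs
  rw [add_mul, add_mul] at hcard
  have h1 : q * (2 * n + 3) ≤ q * (2 * n + 3) * s ^ (2 * n + 1) :=
    Nat.le_mul_of_pos_right _ hpow
  have h2 : (2 * s ^ 2) ^ n ≤ 2 ^ n * s ^ (2 * n + 1) := by
    rw [mul_pow, ← pow_mul]
    exact Nat.mul_le_mul_left _ (Nat.pow_le_pow_right hs (by omega))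
  suffices h : ∃ S : Finset V, m ≤ S.card ∧ ∀ I ⊆ S, G.IsIndepSet (I : Set V) → I.card ≤ q by
    obtain ⟨S, hSm, hS⟩ := h
    obtain ⟨S', hS', hS'c⟩ := Finset.exists_subset_card_eq hSm
    exact ⟨S', hS'c, fun I hI => hS I (hI.trans hS')⟩
  have hp : q / 2 * (2 * n + 3) ≤ q * (2 * n + 3) :=
    Nat.mul_le_mul_right _ (Nat.div_le_self _ _)
  obtain ⟨S, -, hSc, hS⟩ := hC V G s hα (q / 2) Finset.univ (by
    rw [Finset.card_univ]
    have := Nat.pow_pos (n := n) (show 0 < 2 by norm_num)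
    have := Nat.mul_pos this hpow
    omega)
  obtain ⟨p, rfl | rfl⟩ := Nat.even_or_odd' q
  · have e : 2 * p / 2 = p := by omega
    rw [e] at hSc hS
    exact ⟨S, by rw [hSc]; linarith, hS⟩
  · have e : (2 * p + 1) / 2 = p := by omega
    rw [e] at hSc hS hp
    obtain ⟨K, hK, hKq, hKc⟩ : ∃ K ⊆ Sᶜ, G.IsClique (K : Set V) ∧ n < K.card := by
      by_contra! hcon
      have h3 := G.card_le_pow_of_clique_card_le hα n Sᶜ hcon
      have h4 := Finset.card_add_card_compl S
      omega
    have hdisj : Disjoint S K :=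
      Finset.disjoint_left.2 fun y hy hy' => Finset.mem_compl.1 (hK hy') hy
    refine ⟨S ∪ K, ?_, fun I hI hIi => ?_⟩
    · rw [Finset.card_union_of_disjoint hdisj, hSc]
      -- `2 * m ≤ (2 * n + 3) * (2 * p + 1)` and the right-hand side is odd
      have e' : (2 * n + 3) * (2 * p + 1) = 2 * (p * (2 * n + 3) + n + 1) + 1 := by ring
      omega
    · have h5 := hIi.card_inter_le_one hKq
      have h6 := hS (I ∩ S) Finset.inter_subset_right (hIi.mono (by simp))
      have h7 : I ⊆ (I ∩ S) ∪ (I ∩ K) := by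
        rw [← Finset.inter_union_distrib_left]
        exact Finset.subset_inter subset_rfl hI
      have := (Finset.card_le_card h7).trans (Finset.card_union_le _ _)
      omega

/-- A lower bound on the local independence number provides independent sets in `m`-sets. -/
lemma exists_isIndepSet_of_le_localIndepNum {V : Type*} {G : SimpleGraph V} {m r : ℕ}
    (h : (r : ℕ∞) ≤ G.localIndepNum m) {S : Finset V} (hS : S.card = m) :
    ∃ I ⊆ S, G.IsIndepSet (I : Set V) ∧ r ≤ I.card := by
  have h1 : r ≤ (G.induce (S : Set V)).indepNum := by
    exact_mod_cast h.trans (iInf_le _ (⟨S, hS⟩ : {S : Finset V // S.card = m}))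
  obtain ⟨J, hJ⟩ := (G.induce (S : Set V)).exists_isNIndepSet_indepNum
  refine ⟨J.map (Function.Embedding.subtype _), ?_, ?_, ?_⟩
  · intro y hy
    obtain ⟨z, -, rfl⟩ := Finset.mem_map.1 hy
    exact z.2
  · intro a ha b hb hab hadj
    simp only [Finset.coe_map, Set.mem_image, Finset.mem_coe] at ha hb
    obtain ⟨a, ha, rfl⟩ := ha
    obtain ⟨b, hb, rfl⟩ := hb
    exact hJ.isIndepSet ha hb (fun h => hab (by rw [h])) hadj
  · rw [Finset.card_map, hJ.card_eq]
    exact h1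

end SimpleGraph

theorem mainTheorem2 (m r k : ℕ) (hr : 2 ≤ r)
    (hk : k = ⌈(m : ℝ) / ((r : ℝ) - 1)⌉₊) (hk3 : 3 ≤ k)
    (hm : (m : ℝ) ≤ ((k : ℝ) - 1 / 2) * ((r : ℝ) - 1)) :
    ∃ c : ℝ, 0 < c ∧
      ∀ (V : Type*) [Fintype V] (G : SimpleGraph V),
        (r : ℕ∞) ≤ G.localIndepNum m →
          c * (Fintype.card V : ℝ) ^ (1 / ((k : ℝ) - 3 / 2)) ≤ (G.indepNum : ℝ) := by
  obtain ⟨n, rfl⟩ : ∃ n, k = n + 2 := ⟨k - 2, by omega⟩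
  obtain ⟨q, rfl⟩ : ∃ q, r = q + 1 := ⟨r - 1, by omega⟩
  have hm' : 2 * m ≤ (2 * n + 3) * q := by
    have : (2 * m : ℝ) ≤ (2 * n + 3) * q := by
      push_cast at hm
      linarith
    exact_mod_cast this
  obtain ⟨C, hC⟩ := SimpleGraph.exists_card_eq_indep_le n m q (by omega) hm'
  -- `e = k - 3 / 2`, and the number of vertices is at most `B * α ^ e`
  set e : ℝ := ((n + 2 : ℕ) : ℝ) - 3 / 2 with he
  have he2 : 2 * e = ((2 * n + 1 : ℕ) : ℝ) := by
    rw [he]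
    push_cast
    ring
  have hepos : 0 < e := by
    have : (0 : ℝ) < ((2 * n + 1 : ℕ) : ℝ) := by positivity
    linarith
  set B : ℝ := (C + 1) * 2 ^ (2 * n + 1) with hB
  have hBpos : 0 < B := by positivity
  refine ⟨(B ^ (1 / e))⁻¹, by positivity, fun V _ G hloc => ?_⟩
  set a := G.indepNum with ha
  set N := Fintype.card V with hN
  rcases Nat.eq_zero_or_pos N with h0 | hNpos
  · rw [h0, Nat.cast_zero, Real.zero_rpow (by positivity), mul_zero]
    positivity
  have hapos : 1 ≤ a := by
    obtain ⟨v⟩ := Fintype.card_pos_iff.1 hNpos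
    have : G.IsIndepSet (({v} : Finset V) : Set V) := by simp [SimpleGraph.IsIndepSet]
    simpa using this.card_le_indepNum
  set s := Nat.sqrt a + 1 with hs
  have hNle : N ≤ C * s ^ (2 * n + 1) := by
    by_contra! hlt
    obtain ⟨S, hS, hSI⟩ := hC V G s
      (fun I hI => hI.card_le_indepNum.trans_lt (Nat.lt_succ_sqrt' a)) hlt
    obtain ⟨I, hI, hIi, hIc⟩ := SimpleGraph.exists_isIndepSet_of_le_localIndepNum hloc hS
    have := hSI I hI hIi
    omega
  have hapos' : (1 : ℝ) ≤ a := by exact_mod_cast hapos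
  have hs2 : (s : ℝ) ≤ 2 * Real.sqrt a := by
    have h1 : (Nat.sqrt a : ℝ) ≤ Real.sqrt a := Real.nat_sqrt_le_real_sqrt
    have h2 : 1 ≤ Real.sqrt a := Real.one_le_sqrt.2 hapos'
    rw [hs]
    push_cast
    linarith
  have hsqrt : Real.sqrt a ^ (2 * n + 1) = (a : ℝ) ^ e := by
    rw [Real.sqrt_eq_rpow, ← Real.rpow_natCast, ← Real.rpow_mul (by positivity), ← he2]
    congr 1
    ring
  have hNB : (N : ℝ) ≤ B * (a : ℝ) ^ e := by
    calc (N : ℝ) ≤ C * (s : ℝ) ^ (2 * n + 1) := by exact_mod_cast hNle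
      _ ≤ (C + 1) * (2 * Real.sqrt a) ^ (2 * n + 1) := by
          gcongr
          linarith
      _ = B * (a : ℝ) ^ e := by rw [mul_pow, hsqrt, hB, mul_assoc]
  rw [inv_mul_le_iff₀ (by positivity)]
  calc (N : ℝ) ^ (1 / e) ≤ (B * (a : ℝ) ^ e) ^ (1 / e) := by gcongr
    _ = B ^ (1 / e) * a := by
        rw [Real.mul_rpow hBpos.le (by positivity), ← Real.rpow_mul (by positivity),
          mul_one_div_cancel hepos.ne', Real.rpow_one]
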